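/- Let $d\Omega$ be the surface measure of the unit sphere $\mathbb S^2\subset\mathbb R^3$, write $\langle f\rangle=\int_{\mathbb S^2} f\,d\Omega$, and let $\Omega=(\mu,\xi,\zeta)=(\Omega_x,\Omega_y,\Omega_z)$ be the direction cosines. For indices $i_1,\dots,i_l\in\{x,y,z\}$ put $\Omega_{i_1\cdots i_l}=\Omega_{i_1}\cdots\Omega_{i_l}$. Let $p(\Omega'\to\Omega)=\sum_{l=0}^{L}C_lP_l(\Omega'\cdot\Omega)$ ($P_l$ the Legendre polynomials) be a phase function: $p\ge 0$ and $\int p(\Omega'\to\Omega)\,d\Omega'=1$ for all $\Omega$. For an intensity $I=I(t,x,\Omega)$ let $S(\Omega)=\int p(\Omega'\to\Omega)I(\Omega')\,d\Omega'$ be the scattering source, and $J^{(l)}_{i_1\cdots i_l}=\langle\Omega_{i_1\cdots i_l}I\rangle$, $S^{(l)}_{i_1\cdots i_l}=\langle\Omega_{i_1\cdots i_l}S\rangle$ the angular moments. Let $U\subset\mathbb R\times\mathbb R^3$ be open (a set of points $(t,x)$) and let $\sigma_s>0$ be a $C^1$ scattering coefficient on $U$ (for instance a constant). For odd $l$ consider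 the relations $$J^{(l)}_{i_1\cdots i_l}=\begin{cases}\dfrac{\langle\mu\,\Omega_{i_1\cdots i_l}\rangle}{\langle\mu^2\rangle}J^{(1)}_x & \text{if } x \text{ occurs an odd, and } y,z \text{ an even number of times in } i_1\cdots i_l,\\[2mm] \dfrac{\langle\xi\,\Omega_{i_1\cdots i_l}\rangle}{\langle\mu^2\rangle}J^{(1)}_y & \text{if } y \text{ occurs an odd, and } x,z \text{ an even number of times},\\[2mm] \dfrac{\langle\zeta\,\Omega_{i_1\cdots i_l}\rangle}{\langle\mu^2\rangle}J^{(1)}_z & \text{if } z \text{ occurs an odd, and } x,y \text{ an even number of times},\\[2mm] 0 & \text{if } x,y,z \text{ all occur an odd number of times.}\end{cases}\tag{$*$}$$ (a) Let $c>0$, $\varepsilon_0>0$ and let $(I_\varepsilon)_{0<\varepsilon<\varepsilon_0}$ be classical solutions in $U$ of $$\partial_t I+\frac c\varepsilon\,\Omega\cdot\nabla I=\frac{c\,\sigma_s}{\varepsilon^2}(S-I),$$ of class $C^2$ in $(t,x)$ with derivatives of order at most $2$ continuous in $(t,x,\Omega)$ and bounded uniformly in $\varepsilon$ and $\Omega$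 and locally uniformly in $(t,x)$ (optically thick regime). Then all relations $(*)$ hold up to $O(\varepsilon^2)$: for every compact $K\subset U$ there is $M$ such that for all $0<\varepsilon<\varepsilon_0$, all $(t,x)\in K$, all odd $l$ and all $i_1,\dots,i_l$, the two sides of $(*)$ for $I_\varepsilon$ differ by at most $M\varepsilon^2$. (b) Let $\varepsilon>0$ be fixed and let $I$ be of class $C^1$ in $(t,x)\in U$, with $I$ and its first derivatives continuous in $(t,x,\Omega)$, and let its moments satisfy in $U$ the asymptotic closure $$J^{(m)}=S^{(m)}\quad(m\text{ even}),\qquad J^{(n)}=S^{(n)}-\frac{\varepsilon}{\sigma_s}\nabla\cdot S^{(n+1)}\quad(n\text{ odd}),$$ where $(\nabla\cdot S^{(n+1)})_{i_1\cdots i_n}=\sum_k\partial_{x_k}S^{(n+1)}_{k i_1\cdots i_n}$. Then all relations $(*)$ hold exactly in $U$. -/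

import Mathlib

open MeasureTheory Set

noncomputable section

/-- Physical space `ℝ³`; the coordinates `0, 1, 2` are `x, y, z`. -/
abbrev PhysSpace : Type := EuclideanSpace ℝ (Fin 3)

/-- Space-time points `(t, x)`. -/
abbrev SpaceTime : Type := ℝ × PhysSpace

/-- Directions `Ω = (μ, ξ, ζ)`, the points of the unit sphere of `ℝ³`. -/
abbrev Direction : Type := Metric.sphere (0 : PhysSpace) 1

/-- The direction cosine `Ω_k`: `μ`, `ξ`, `ζ` for `k = 0, 1, 2`. -/
def dirCos (k : Fin 3) (Ω : Direction) : ℝ := (Ω : PhysSpace) k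

/-- Angular integration `⟨f⟩ = ∫ f dΩ`, for the surface measure of the unit sphere
(of total mass `4π`). -/
def angInt (f : Direction → ℝ) : ℝ :=
  ∫ Ω, f Ω ∂((volume : Measure PhysSpace).toSphere)

/-- The product `Ω_{i₁ … i_l} = Ω_{i₁} ⋯ Ω_{i_l}`. -/
def dirProd {l : ℕ} (i : Fin l → Fin 3) (Ω : Direction) : ℝ := ∏ a, dirCos (i a) Ω

/-- The component `⟨Ω_{i₁ … i_l} f⟩` of the `l`-th order angular moment of `f`. -/
def angMoment {l : ℕ} (i : Fin l → Fin 3) (f : Direction → ℝ) : ℝ :=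
  angInt fun Ω => dirProd i Ω * f Ω

/-- The number of occurrences of the index `k` in `i₁ … i_l`. -/
def idxCount {l : ℕ} (i : Fin l → Fin 3) (k : Fin 3) : ℕ :=
  (Finset.univ.filter fun a => i a = k).card

/-- The Legendre polynomial `P_n`, by Rodrigues' formula. -/
def legendrePoly (n : ℕ) : Polynomial ℝ :=
  Polynomial.C (1 / ((2 : ℝ) ^ n * (n.factorial : ℝ))) *
    Polynomial.derivative^[n] ((Polynomial.X ^ 2 - 1) ^ n)

/-- `∑_{l ≤ L} C_l P_l(s)`, a function of the cosine `s` of the scattering angle. -/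
def phaseFun (L : ℕ) (C : ℕ → ℝ) (s : ℝ) : ℝ :=
  ∑ l ∈ Finset.range (L + 1), C l * (legendrePoly l).eval s

/-- The scattering kernel `p(Ω' → Ω) = ∑_{l ≤ L} C_l P_l(Ω' · Ω)`. -/
def scatKernel (L : ℕ) (C : ℕ → ℝ) (Ω' Ω : Direction) : ℝ :=
  phaseFun L C (inner ℝ (Ω' : PhysSpace) (Ω : PhysSpace))

/-- The kernel is a probability density with respect to the angular variable. -/
structure IsPhaseFunction (L : ℕ) (C : ℕ → ℝ) : Prop where
  nonneg : ∀ Ω' Ω, 0 ≤ scatKernel L C Ω' Ω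
  normalized : ∀ Ω, angInt (fun Ω' => scatKernel L C Ω' Ω) = 1

/-- The scattering source `S(Ω) = ∫ p(Ω' → Ω) I(Ω') dΩ'`. -/
def scatSource (L : ℕ) (C : ℕ → ℝ) (f : Direction → ℝ) (Ω : Direction) : ℝ :=
  angInt fun Ω' => scatKernel L C Ω' Ω * f Ω'

/-- The spatial partial derivative `∂F/∂x_k` at the space-time point `z`. -/
def spacePartial (k : Fin 3) (F : SpaceTime → ℝ) (z : SpaceTime) : ℝ :=
  fderiv ℝ (fun y : PhysSpace => F (z.1, y)) z.2 (EuclideanSpace.single k 1)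

/-- The time derivative `∂F/∂t` at the space-time point `z`. -/
def timePartial (F : SpaceTime → ℝ) (z : SpaceTime) : ℝ :=
  deriv (fun t : ℝ => F (t, z.2)) z.1

/-- `f(t, x, Ω)` is of class `C^k` in `(t, x) ∈ U`, and its derivatives of order at most `k`
in `(t, x)` are jointly continuous in `(t, x, Ω)`. -/
structure RegularIntensity (k : ℕ) (U : Set SpaceTime) (f : SpaceTime → Direction → ℝ) : Prop where
  contDiffOn : ∀ Ω, ContDiffOn ℝ k (fun z => f z Ω) U
  continuousOn : ∀ j ≤ k, ContinuousOn
    (fun q : SpaceTime × Direction => iteratedFDeriv ℝ j (fun z => f z q.2) q.1) (U ×ˢ univ)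

/-- The scaled transport equation
`∂_t I + (c / ε) Ω · ∇I = (c σ / ε²) (S - I)` in `U`, for all directions. -/
def SolvesTransport (L : ℕ) (C : ℕ → ℝ) (c : ℝ) (σ : SpaceTime → ℝ) (ε : ℝ)
    (U : Set SpaceTime) (f : SpaceTime → Direction → ℝ) : Prop :=
  ∀ z ∈ U, ∀ Ω : Direction,
    timePartial (fun w => f w Ω) z
        + c / ε * ∑ k, dirCos k Ω * spacePartial k (fun w => f w Ω) z
      = c * σ z / ε ^ 2 * (scatSource L C (f z) Ω - f z Ω)

/-- The optically thick asymptotic regime: `(I_ε)`, `0 < ε < ε₀`, is a family of classical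
solutions of the scaled transport equation which varies on the macroscopic scale, that is, its
derivatives in `(t, x)` of order at most two are bounded, uniformly in `ε` and `Ω` and locally
uniformly in `(t, x)`. -/
structure IsThickFamily (L : ℕ) (C : ℕ → ℝ) (c : ℝ) (σ : SpaceTime → ℝ) (ε₀ : ℝ)
    (U : Set SpaceTime) (I : ℝ → SpaceTime → Direction → ℝ) : Prop where
  regular : ∀ ε ∈ Ioo 0 ε₀, RegularIntensity 2 U (I ε)
  solves : ∀ ε ∈ Ioo 0 ε₀, SolvesTransport L C c σ ε U (I ε)
  bounded : ∀ K ⊆ U, IsCompact K → ∃ B : ℝ, ∀ ε ∈ Ioo 0 ε₀, ∀ z ∈ K, ∀ Ω, ∀ j ≤ 2,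
    ‖iteratedFDeriv ℝ j (fun w => I ε w Ω) z‖ ≤ B

/-- The asymptotic closure of the moments at a fixed `ε`: for even `m` and odd `n`,
`J^(m) = S^(m)` and `J^(n) = S^(n) - (ε / σ) ∇ · S^(n+1)`. -/
structure SatisfiesClosure (L : ℕ) (C : ℕ → ℝ) (σ : SpaceTime → ℝ) (ε : ℝ)
    (U : Set SpaceTime) (f : SpaceTime → Direction → ℝ) : Prop where
  even : ∀ (m : ℕ) (i : Fin m → Fin 3), Even m → ∀ z ∈ U,
    angMoment i (f z) = angMoment i (scatSource L C (f z))
  odd : ∀ (n : ℕ) (i : Fin n → Fin 3), Odd n → ∀ z ∈ U,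
    angMoment i (f z) = angMoment i (scatSource L C (f z))
      - ε * (1 / σ z) * ∑ k, spacePartial k
          (fun w => angMoment (Fin.cons k i : Fin (n + 1) → Fin 3) (scatSource L C (f w))) z

/-- The relations between the odd-order moments of an angular distribution `f` and its first
moments `J_x, J_y, J_z`, where the two sides are compared by the relation `R` (equality, or
equality up to an error). -/
def OddMomentRelations (R : ℝ → ℝ → Prop) (f : Direction → ℝ) : Prop :=
  ∀ (l : ℕ) (i : Fin l → Fin 3), Odd l →
    (Odd (idxCount i 0) ∧ Even (idxCount i 1) ∧ Even (idxCount i 2) →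
      R (angMoment i f)
        (angInt (fun Ω => dirCos 0 Ω * dirProd i Ω) / angInt (fun Ω => dirCos 0 Ω ^ 2)
          * angMoment ![0] f)) ∧
    (Even (idxCount i 0) ∧ Odd (idxCount i 1) ∧ Even (idxCount i 2) →
      R (angMoment i f)
        (angInt (fun Ω => dirCos 1 Ω * dirProd i Ω) / angInt (fun Ω => dirCos 0 Ω ^ 2)
          * angMoment ![1] f)) ∧
    (Even (idxCount i 0) ∧ Even (idxCount i 1) ∧ Odd (idxCount i 2) →
      R (angMoment i f)
        (angInt (fun Ω => dirCos 2 Ω * dirProd i Ω) / angInt (fun Ω => dirCos 0 Ω ^ 2)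
          * angMoment ![2] f)) ∧
    (Odd (idxCount i 0) ∧ Odd (idxCount i 1) ∧ Odd (idxCount i 2) →
      R (angMoment i f) 0)

end

/-! Write `S f` for the scattering source of `f`. Both parts reduce to one stability fact,
`IsPhaseFunction.exists_affine_approx`: if `f - S f` is within `η` of a linear function `v · Ω`,
then `f` is within `M η` of an affine function `β + b · Ω`. Affine functions satisfy the relations
exactly, by reflection symmetry and `⟨Ω_j²⟩ = ⟨μ²⟩`; since `|Ω_{i₁…i_l}| ≤ 1`, the error in the
moments is uniform in `l` (`exists_oddMomentRelations_of_affine`).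

The stability fact has two sources. The operator `S` commutes with rotations, so the `Ω_k` are
eigenfunctions with a common eigenvalue `γ`. Any two kernels `p(· → A)`, `p(· → B)` share a mass at
least `κ > 0`, so `S` contracts oscillations by `1 - κ` (Doeblin), whence `osc f ≤ (2/κ) sup |f - S
f|`. In particular `γ ≠ 1`, and the linear part can be solved for and subtracted.

For (a), the equation reads `I - S = -(ε/σ) Ω · ∇I - (ε²/(cσ)) ∂_t I`. Differentiated in `x_k` it
gives `∂_k I - S(∂_k I) = O(ε)`, so `∇I` is isotropic up to `O(ε)` and `I - S` is linear in `Ω` up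
to `O(ε²)`.

For (b), a continuous function is determined by its moments. The even closure makes the even part of
`I` isotropic; the odd closure then makes `I - S` exactly linear, and the stability fact applies
with `η = 0`. -/

noncomputable section

/-! ### Rotation invariance and angular integration. -/

/-- The action of a linear isometry on directions. -/
def rotate (R : PhysSpace ≃ₗᵢ[ℝ] PhysSpace) (Ω : Direction) : Direction :=
  ⟨R Ω, by simp⟩

@[simp] lemma coe_rotate (R : PhysSpace ≃ₗᵢ[ℝ] PhysSpace) (Ω : Direction) :
    (rotate R Ω : PhysSpace) = R Ω := rfl

lemma continuous_rotate (R : PhysSpace ≃ₗᵢ[ℝ] PhysSpace) : Continuous (rotate R) :=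
  (R.continuous.comp continuous_subtype_val).subtype_mk _

lemma rotate_symm_rotate (R : PhysSpace ≃ₗᵢ[ℝ] PhysSpace) (Ω : Direction) :
    rotate R.symm (rotate R Ω) = Ω := by ext1; simp

/-- `rotate R` as a homeomorphism of the sphere. -/
def rotateHomeomorph (R : PhysSpace ≃ₗᵢ[ℝ] PhysSpace) : Direction ≃ₜ Direction where
  toFun := rotate R
  invFun := rotate R.symm
  left_inv := rotate_symm_rotate R
  right_inv Ω := by simpa using rotate_symm_rotate R.symm Ω
  continuous_toFun := continuous_rotate R
  continuous_invFun := continuous_rotate R.symm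

-- The surface measure of `s` is a multiple of the volume of the cone `(0, 1) • s`; forming cones
-- commutes with `R`, and `R` preserves volume.
open Pointwise in
lemma measurePreserving_rotate (R : PhysSpace ≃ₗᵢ[ℝ] PhysSpace) :
    MeasurePreserving (rotate R) (volume : Measure PhysSpace).toSphere
      (volume : Measure PhysSpace).toSphere := by
  refine ⟨(continuous_rotate R).measurable, ?_⟩
  ext s hs
  rw [Measure.map_apply (continuous_rotate R).measurable hs, Measure.toSphere_apply' _ hs,
    Measure.toSphere_apply' _ ((continuous_rotate R).measurable hs)]
  congr 1
  have h : Ioo (0 : ℝ) 1 • ((↑) '' (rotate R ⁻¹' s) : Set PhysSpace)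
      = R ⁻¹' (Ioo (0 : ℝ) 1 • ((↑) '' s : Set PhysSpace)) := by
    ext y
    simp only [Set.mem_smul, mem_preimage, mem_image]
    constructor
    · rintro ⟨r, hr, _, ⟨Ω, hΩ, rfl⟩, rfl⟩
      exact ⟨r, hr, _, ⟨rotate R Ω, hΩ, rfl⟩, by simp⟩
    · rintro ⟨r, hr, _, ⟨Ω, hΩ, rfl⟩, hy⟩
      refine ⟨r, hr, _, ⟨rotate R.symm Ω, ?_, rfl⟩, ?_⟩
      · simpa using (rotate_symm_rotate R.symm Ω).symm ▸ hΩ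
      · rw [coe_rotate, ← map_smul, hy, R.symm_apply_apply]
  rw [h]
  exact R.measurePreserving.measure_preimage_emb R.toHomeomorph.measurableEmbedding _

lemma angInt_rotate (R : PhysSpace ≃ₗᵢ[ℝ] PhysSpace) (f : Direction → ℝ) :
    angInt (fun Ω => f (rotate R Ω)) = angInt f :=
  (measurePreserving_rotate R).integral_comp (rotateHomeomorph R).measurableEmbedding f

lemma Continuous.integrable_direction {f : Direction → ℝ} (hf : Continuous f) :
    Integrable f (volume : Measure PhysSpace).toSphere :=
  hf.integrable_of_hasCompactSupport (HasCompactSupport.of_compactSpace f)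

lemma angInt_add {f g : Direction → ℝ} (hf : Continuous f) (hg : Continuous g) :
    angInt (fun Ω => f Ω + g Ω) = angInt f + angInt g :=
  integral_add hf.integrable_direction hg.integrable_direction

lemma angInt_sub {f g : Direction → ℝ} (hf : Continuous f) (hg : Continuous g) :
    angInt (fun Ω => f Ω - g Ω) = angInt f - angInt g :=
  integral_sub hf.integrable_direction hg.integrable_direction

lemma angInt_const_mul (a : ℝ) (f : Direction → ℝ) :
    angInt (fun Ω => a * f Ω) = a * angInt f :=
  integral_const_mul a f

lemma angInt_neg (f : Direction → ℝ) : angInt (fun Ω => -f Ω) = -angInt f :=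
  integral_neg f

lemma angInt_sum {ι : Type*} (s : Finset ι) {f : ι → Direction → ℝ}
    (hf : ∀ k ∈ s, Continuous (f k)) :
    angInt (fun Ω => ∑ k ∈ s, f k Ω) = ∑ k ∈ s, angInt (f k) :=
  integral_finsetSum s fun k hk => (hf k hk).integrable_direction

lemma angInt_mono {f g : Direction → ℝ} (hf : Continuous f) (hg : Continuous g)
    (h : ∀ Ω, f Ω ≤ g Ω) : angInt f ≤ angInt g :=
  integral_mono hf.integrable_direction hg.integrable_direction h

lemma angInt_pos {f : Direction → ℝ} (hf : Continuous f) (h : ∀ Ω, 0 ≤ f Ω) {Ω₀ : Direction}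
    (h₀ : 0 < f Ω₀) : 0 < angInt f :=
  hf.integral_pos_of_hasCompactSupport_nonneg_nonzero (HasCompactSupport.of_compactSpace f) h h₀.ne'

/-- The area of the unit sphere. -/
def sphereArea : ℝ := angInt fun _ => 1

lemma sphereArea_nonneg : 0 ≤ sphereArea := integral_nonneg fun _ => zero_le_one

lemma abs_angInt_le {f : Direction → ℝ} {η : ℝ} (h : ∀ Ω, |f Ω| ≤ η) :
    |angInt f| ≤ η * sphereArea := by
  have := norm_integral_le_of_norm_le_const (μ := (volume : Measure PhysSpace).toSphere)
    (f := f) (C := η) (.of_forall h)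
  simpa [sphereArea, angInt] using this

/-! ### Integrals of products of direction cosines. -/

lemma continuous_dirCos (k : Fin 3) : Continuous (dirCos k) := by
  unfold dirCos; fun_prop

lemma continuous_dirProd {l : ℕ} (i : Fin l → Fin 3) : Continuous (dirProd i) := by
  unfold dirProd
  exact continuous_finsetProd _ fun a _ => continuous_dirCos (i a)

lemma abs_dirCos_le_one (k : Fin 3) (Ω : Direction) : |dirCos k Ω| ≤ 1 := by
  have := PiLp.norm_apply_le (Ω : PhysSpace) k
  simpa [dirCos] using this

lemma abs_dirProd_le_one {l : ℕ} (i : Fin l → Fin 3) (Ω : Direction) : |dirProd i Ω| ≤ 1 := by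
  unfold dirProd
  rw [Finset.abs_prod]
  exact Finset.prod_le_one (fun _ _ => abs_nonneg _) fun a _ => abs_dirCos_le_one (i a) Ω

lemma dirCos_mul_dirProd {l : ℕ} (k : Fin 3) (i : Fin l → Fin 3) (Ω : Direction) :
    dirCos k Ω * dirProd i Ω = dirProd (Fin.cons k i : Fin (l + 1) → Fin 3) Ω := by
  simp [dirProd, Fin.prod_univ_succ]

lemma idxCount_cons {l : ℕ} (k j : Fin 3) (i : Fin l → Fin 3) :
    idxCount (Fin.cons k i : Fin (l + 1) → Fin 3) j = (if k = j then 1 else 0) + idxCount i j := by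
  simp only [idxCount, Finset.card_filter, Fin.sum_univ_succ, Fin.cons_zero, Fin.cons_succ]

lemma dirProd_eq_prod_pow {l : ℕ} (i : Fin l → Fin 3) (Ω : Direction) :
    dirProd i Ω = ∏ k, dirCos k Ω ^ idxCount i k := by
  unfold dirProd idxCount
  rw [← Finset.prod_fiberwise' Finset.univ i fun k => dirCos k Ω]
  simp

/-- The reflection which changes the sign of the coordinate `k`. -/
def flipCoord (k : Fin 3) : PhysSpace ≃ₗᵢ[ℝ] PhysSpace :=
  LinearIsometryEquiv.piLpCongrRight 2 fun j =>
    if j = k then LinearIsometryEquiv.neg ℝ else LinearIsometryEquiv.refl ℝ ℝ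

lemma dirCos_rotate_flipCoord (j k : Fin 3) (Ω : Direction) :
    dirCos j (rotate (flipCoord k) Ω) = if j = k then -dirCos j Ω else dirCos j Ω := by
  simp only [dirCos, coe_rotate, flipCoord, LinearIsometryEquiv.piLpCongrRight_apply]
  split_ifs <;> simp

/-- The reflection `Ω_k ↦ -Ω_k` changes the sign of the integrand. -/
lemma angInt_dirProd_eq_zero {l : ℕ} {i : Fin l → Fin 3} {k : Fin 3} (h : Odd (idxCount i k)) :
    angInt (dirProd i) = 0 := by
  have hflip (Ω : Direction) : dirProd i (rotate (flipCoord k) Ω) = -dirProd i Ω := by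
    simp only [dirProd_eq_prod_pow, dirCos_rotate_flipCoord]
    rw [← Finset.mul_prod_erase _ _ (Finset.mem_univ k),
      ← Finset.mul_prod_erase _ _ (Finset.mem_univ k), if_pos rfl, h.neg_pow, neg_mul]
    congr 2
    exact Finset.prod_congr rfl fun j hj => by rw [if_neg (Finset.ne_of_mem_erase hj)]
  have h1 := angInt_rotate (flipCoord k) (dirProd i)
  simp only [hflip] at h1
  rw [angInt_neg] at h1
  linarith

lemma angInt_dirCos_mul_dirProd_eq_zero {l : ℕ} {i : Fin l → Fin 3} {j k : Fin 3}
    (hjk : k ≠ j) (h : Odd (idxCount i j)) :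
    angInt (fun Ω => dirCos k Ω * dirProd i Ω) = 0 := by
  simp only [dirCos_mul_dirProd]
  apply angInt_dirProd_eq_zero (k := j)
  simpa [idxCount_cons, hjk] using h

lemma angInt_dirCos_sq (k : Fin 3) :
    angInt (fun Ω => dirCos k Ω ^ 2) = angInt fun Ω => dirCos 0 Ω ^ 2 := by
  rw [← angInt_rotate (LinearIsometryEquiv.piLpCongrLeft 2 ℝ ℝ (Equiv.swap 0 k))]
  simp [dirCos, LinearIsometryEquiv.piLpCongrLeft_apply]

/-- The direction along a coordinate axis. -/
def axisDir (k : Fin 3) : Direction := ⟨EuclideanSpace.single k 1, by simp⟩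

lemma angInt_dirCos_zero_sq_pos : 0 < angInt (fun Ω => dirCos 0 Ω ^ 2) :=
  angInt_pos ((continuous_dirCos 0).pow 2) (fun _ => sq_nonneg _) (Ω₀ := axisDir 0)
    (by simp [dirCos, axisDir])

/-! ### The scattering operator and its rotation equivariance. -/

/-- The phase function as a polynomial in the cosine of the scattering angle. -/
def phasePoly (L : ℕ) (C : ℕ → ℝ) : Polynomial ℝ :=
  ∑ l ∈ Finset.range (L + 1), Polynomial.C (C l) * legendrePoly l

variable {L : ℕ} {C : ℕ → ℝ}

lemma phaseFun_eq_eval (s : ℝ) : phaseFun L C s = (phasePoly L C).eval s := by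
  simp [phaseFun, phasePoly, Polynomial.eval_finsetSum]

lemma continuous_phaseFun : Continuous (phaseFun L C) := by
  simp only [funext phaseFun_eq_eval]
  exact (phasePoly L C).continuous

lemma Continuous.scatKernel {X : Type*} [TopologicalSpace X] {u v : X → Direction}
    (hu : Continuous u) (hv : Continuous v) : Continuous fun q => scatKernel L C (u q) (v q) :=
  continuous_phaseFun.comp
    ((continuous_subtype_val.comp hu).inner (continuous_subtype_val.comp hv))

lemma scatKernel_rotate (R : PhysSpace ≃ₗᵢ[ℝ] PhysSpace) (Ω' Ω : Direction) :
    scatKernel L C (rotate R Ω') (rotate R Ω) = scatKernel L C Ω' Ω := by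
  simp [scatKernel]

lemma continuous_angInt {X : Type*} [TopologicalSpace X] [FirstCountableTopology X]
    [LocallyCompactSpace X] {f : X → Direction → ℝ} (hf : Continuous f.uncurry) :
    Continuous fun x => angInt (f x) := by
  have := continuous_parametric_integral_of_continuous
    (μ := (volume : Measure PhysSpace).toSphere) hf isCompact_univ
  simpa [angInt] using this

lemma continuous_scatSource {f : Direction → ℝ} (hf : Continuous f) :
    Continuous (scatSource L C f) :=
  continuous_angInt (f := fun Ω Ω' => scatKernel L C Ω' Ω * f Ω')
    ((continuous_snd.scatKernel continuous_fst).mul (hf.comp continuous_snd))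

lemma continuous_scatKernel_mul {f : Direction → ℝ} (hf : Continuous f) (Ω : Direction) :
    Continuous fun Ω' => scatKernel L C Ω' Ω * f Ω' :=
  (continuous_id.scatKernel continuous_const).mul hf

lemma scatSource_add {f g : Direction → ℝ} (hf : Continuous f) (hg : Continuous g)
    (Ω : Direction) :
    scatSource L C (fun Ω => f Ω + g Ω) Ω = scatSource L C f Ω + scatSource L C g Ω := by
  simp only [scatSource, mul_add]
  exact angInt_add (continuous_scatKernel_mul hf Ω) (continuous_scatKernel_mul hg Ω)

lemma scatSource_sub {f g : Direction → ℝ} (hf : Continuous f) (hg : Continuous g)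
    (Ω : Direction) :
    scatSource L C (fun Ω => f Ω - g Ω) Ω = scatSource L C f Ω - scatSource L C g Ω := by
  simp only [scatSource, mul_sub]
  exact angInt_sub (continuous_scatKernel_mul hf Ω) (continuous_scatKernel_mul hg Ω)

lemma scatSource_const_mul (a : ℝ) (f : Direction → ℝ) (Ω : Direction) :
    scatSource L C (fun Ω => a * f Ω) Ω = a * scatSource L C f Ω := by
  simp only [scatSource, mul_left_comm _ a]
  exact angInt_const_mul a _

lemma scatSource_sum {ι : Type*} (s : Finset ι) {f : ι → Direction → ℝ}
    (hf : ∀ k ∈ s, Continuous (f k)) (Ω : Direction) :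
    scatSource L C (fun Ω => ∑ k ∈ s, f k Ω) Ω = ∑ k ∈ s, scatSource L C (f k) Ω := by
  simp only [scatSource, Finset.mul_sum]
  exact angInt_sum s fun k hk => continuous_scatKernel_mul (hf k hk) Ω

lemma scatSource_rotate (R : PhysSpace ≃ₗᵢ[ℝ] PhysSpace) (f : Direction → ℝ) (Ω : Direction) :
    scatSource L C f (rotate R Ω) = scatSource L C (fun Ω => f (rotate R Ω)) Ω := by
  rw [scatSource, ← angInt_rotate R]
  simp only [scatKernel_rotate]
  rfl

/-- Linear functions of the direction are eigenfunctions of the scattering operator, for a common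
eigenvalue: this is the case of degree one of the Funk-Hecke formula. -/
lemma exists_scatSource_inner :
    ∃ γ : ℝ, ∀ (w : PhysSpace) (Ω : Direction),
      scatSource L C (fun Ω' => inner ℝ w (Ω' : PhysSpace)) Ω = γ * inner ℝ w (Ω : PhysSpace) := by
  set V : PhysSpace → Direction → ℝ := fun w Ω =>
    scatSource L C (fun Ω' => inner ℝ w (Ω' : PhysSpace)) Ω with hV
  have hcont (w : PhysSpace) : Continuous fun Ω' : Direction => inner ℝ w (Ω' : PhysSpace) :=
    continuous_const.inner continuous_subtype_val
  have hrot (R : PhysSpace ≃ₗᵢ[ℝ] PhysSpace) (w : PhysSpace) (Ω : Direction) :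
      V (R w) (rotate R Ω) = V w Ω := by
    simp only [hV]
    rw [scatSource_rotate]
    simp
  -- The reflection in the plane orthogonal to `w` fixes `Ω` and sends `w` to `-w`.
  have hperp (w : PhysSpace) (Ω : Direction) (h : inner ℝ (Ω : PhysSpace) w = 0) : V w Ω = 0 := by
    have h1 := hrot (Submodule.reflection (ℝ ∙ w)ᗮ) w Ω
    have h2 : rotate (Submodule.reflection (ℝ ∙ w)ᗮ) Ω = Ω := by
      ext1
      exact Submodule.reflection_mem_subspace_eq_self
        (Submodule.mem_orthogonal_singleton_iff_inner_left.2 h)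
    rw [Submodule.reflection_orthogonalComplement_singleton_eq_neg, h2] at h1
    have h3 : V (-w) Ω = -V w Ω := by
      have := scatSource_const_mul (L := L) (C := C) (-1)
        (fun Ω' : Direction => inner ℝ w (Ω' : PhysSpace)) Ω
      simpa [hV] using this
    linarith
  -- A reflection carries `axisDir 0` to `Ω`, so the diagonal value is constant; it is the
  -- eigenvalue.
  have hdiag (Ω : Direction) : V Ω Ω = V (axisDir 0) (axisDir 0) := by
    have h2 : Submodule.reflection (ℝ ∙ ((axisDir 0 : PhysSpace) - Ω))ᗮ (axisDir 0 : PhysSpace)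
        = Ω := Submodule.reflection_sub (by rw [norm_eq_of_mem_sphere, norm_eq_of_mem_sphere])
    have h1 := hrot (Submodule.reflection (ℝ ∙ ((axisDir 0 : PhysSpace) - Ω))ᗮ)
      (axisDir 0) (axisDir 0)
    rwa [h2, show rotate _ (axisDir 0) = Ω from Subtype.ext h2] at h1
  refine ⟨V (axisDir 0) (axisDir 0), fun w Ω => ?_⟩
  set a : ℝ := inner ℝ w (Ω : PhysSpace) with ha
  have hdecomp : V w Ω = a * V Ω Ω + V (w - a • (Ω : PhysSpace)) Ω := by
    have h1 := scatSource_add (L := L) (C := C) (f := fun Ω' : Direction =>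
      a * inner ℝ (Ω : PhysSpace) (Ω' : PhysSpace)) (continuous_const.mul (hcont _))
      (hcont (w - a • (Ω : PhysSpace))) Ω
    rw [scatSource_const_mul] at h1
    rw [← h1]
    simp [hV, inner_sub_left, inner_smul_left]
  rw [hperp (w - _), hdiag] at hdecomp
  · change V w Ω = _
    rw [hdecomp]; ring
  · rw [inner_sub_right, inner_smul_right, real_inner_self_eq_norm_sq, norm_eq_of_mem_sphere,
      real_inner_comm, ← ha]
    ring

lemma exists_scatSource_dirCos :
    ∃ γ : ℝ, ∀ k Ω, scatSource L C (dirCos k) Ω = γ * dirCos k Ω := by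
  obtain ⟨γ, hγ⟩ := exists_scatSource_inner (L := L) (C := C)
  refine ⟨γ, fun k Ω => ?_⟩
  have h (Ω : Direction) : inner ℝ (EuclideanSpace.single k (1 : ℝ)) (Ω : PhysSpace)
      = dirCos k Ω := by
    simp [EuclideanSpace.inner_single_left, dirCos]
  simpa only [h] using hγ (EuclideanSpace.single k 1) Ω

/-! ### Contraction of oscillations by scattering. -/

lemma IsPhaseFunction.phasePoly_ne_zero (hp : IsPhaseFunction L C) : phasePoly L C ≠ 0 := by
  intro h
  have h1 := hp.normalized (axisDir 0)
  simp [scatKernel, phaseFun_eq_eval, h, angInt] at h1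

/-- The kernel is a nonnegative nonzero polynomial in the cosine, so it is positive off finitely
many cosines. A direction nearly orthogonal to both `A` and `B`, with small nonzero cosines `s` and
`± s`, avoids them; only the root `0` could obstruct, hence the tilt away from exact orthogonality.
-/
lemma IsPhaseFunction.exists_common_pos (hp : IsPhaseFunction L C) (A B : Direction) :
    ∃ Ω, 0 < scatKernel L C Ω A ∧ 0 < scatKernel L C Ω B := by
  obtain ⟨δ, hδ, hroot⟩ : ∃ δ > 0, ∀ s : ℝ, s ≠ 0 → |s| < δ → phaseFun L C s ≠ 0 := by
    have hfin : {s : ℝ | (phasePoly L C).IsRoot s}.Finite :=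
      Polynomial.finite_setOfPred_isRoot hp.phasePoly_ne_zero
    have hmem : ({s : ℝ | (phasePoly L C).IsRoot s} \ {0})ᶜ ∈ nhds (0 : ℝ) :=
      (hfin.subset sdiff_subset).isClosed.isOpen_compl.mem_nhds (by simp)
    obtain ⟨δ, hδ, hsub⟩ := Metric.mem_nhds_iff.1 hmem
    refine ⟨δ, hδ, fun s hs hsδ h => hsub (a := s) (by simpa using hsδ) ⟨?_, hs⟩⟩
    rwa [phaseFun_eq_eval] at h
  obtain ⟨n, hn, hn0⟩ : ∃ n ∈ (Submodule.span ℝ {(A : PhysSpace), (B : PhysSpace)})ᗮ, n ≠ 0 := by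
    apply Submodule.exists_mem_ne_zero_of_ne_bot
    rw [Ne, Submodule.orthogonal_eq_bot_iff]
    intro htop
    have h1 := finrank_span_finset_le_card (R := ℝ) ({(A : PhysSpace), (B : PhysSpace)} : Finset _)
    have h2 := (Finset.card_le_two (a := (A : PhysSpace)) (b := B))
    rw [Set.finrank, Finset.coe_pair, htop, finrank_top, finrank_euclideanSpace_fin] at h1
    omega
  have hnA : inner ℝ n (A : PhysSpace) = 0 :=
    Submodule.inner_left_of_mem_orthogonal (Submodule.subset_span (by simp)) hn
  have hnB : inner ℝ n (B : PhysSpace) = 0 :=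
    Submodule.inner_left_of_mem_orthogonal (Submodule.subset_span (by simp)) hn
  have hAA : inner ℝ (A : PhysSpace) (A : PhysSpace) = 1 := by simp
  have hBB : inner ℝ (B : PhysSpace) (B : PhysSpace) = 1 := by simp
  -- The sign makes `e ⟨A, B⟩ ≥ 0`, so the tilt along `A + e B` keeps both cosines nonzero even for
  -- antipodal `A`, `B`.
  obtain ⟨e, he, hc⟩ : ∃ e : ℝ, e * e = 1 ∧ 1 ≤ 1 + e * inner ℝ (A : PhysSpace) (B : PhysSpace) := by
    rcases le_total 0 (inner ℝ (A : PhysSpace) (B : PhysSpace)) with h | h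
    · exact ⟨1, by norm_num, by linarith⟩
    · exact ⟨-1, by norm_num, by linarith⟩
  have habs : |e| = 1 := by
    rcases mul_self_eq_one_iff.1 he with h | h <;> simp [h]
  have hc2 : 1 + e * inner ℝ (A : PhysSpace) (B : PhysSpace) ≤ 2 := by
    have h1 := abs_real_inner_le_norm (A : PhysSpace) (B : PhysSpace)
    rw [norm_eq_of_mem_sphere, norm_eq_of_mem_sphere] at h1
    have h2 := le_abs_self (e * inner ℝ (A : PhysSpace) (B : PhysSpace))
    rw [abs_mul, habs] at h2
    linarith
  set c := 1 + e * inner ℝ (A : PhysSpace) (B : PhysSpace) with hcdef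
  have hnpos : 0 < ‖n‖ := norm_pos_iff.2 hn0
  -- With `c ≤ 2` and `‖w‖ ≥ ‖n‖`, this yields `s ≤ δ / 2`.
  set t : ℝ := δ * ‖n‖ / 4 with ht
  have htpos : 0 < t := by positivity
  set w : PhysSpace := n + t • ((A : PhysSpace) + e • (B : PhysSpace)) with hw
  have hwA : inner ℝ w (A : PhysSpace) = t * c := by
    rw [hw, inner_add_left, inner_smul_left, inner_add_left, inner_smul_left, hnA, hAA,
      real_inner_comm, hcdef]
    simp
  have hwB : inner ℝ w (B : PhysSpace) = e * (t * c) := by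
    rw [hw, inner_add_left, inner_smul_left, inner_add_left, inner_smul_left, hnB, hBB, hcdef]
    simp only [conj_trivial]
    linear_combination (-t * inner ℝ (A : PhysSpace) (B : PhysSpace)) * he
  have hnw : ‖n‖ ≤ ‖w‖ := by
    have h1 : inner ℝ n w = ‖n‖ * ‖n‖ := by
      rw [hw, inner_add_right, inner_smul_right, inner_add_right, inner_smul_right, hnA, hnB,
        real_inner_self_eq_norm_mul_norm]
      simp
    have h2 := real_inner_le_norm n w
    rw [h1] at h2
    exact le_of_mul_le_mul_left h2 hnpos
  have hwpos : 0 < ‖w‖ := hnpos.trans_le hnw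
  set s : ℝ := ‖w‖⁻¹ * (t * c) with hs
  have hspos : 0 < s := by
    have : 0 < c := by linarith
    positivity
  have hslt : s < δ := by
    rw [hs, inv_mul_lt_iff₀ hwpos]
    calc t * c ≤ t * 2 := by gcongr
      _ = δ * ‖n‖ / 2 := by rw [ht]; ring
      _ < δ * ‖n‖ := by have : 0 < δ * ‖n‖ := by positivity
                        linarith
      _ ≤ ‖w‖ * δ := by rw [mul_comm]; gcongr
  let Ω : Direction := ⟨‖w‖⁻¹ • w, by
    rw [mem_sphere_zero_iff_norm, norm_smul, norm_inv, norm_norm, inv_mul_cancel₀ hwpos.ne']⟩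
  have hΩA : inner ℝ (Ω : PhysSpace) (A : PhysSpace) = s := by
    simp only [Ω, inner_smul_left, hwA, hs, conj_trivial]
  have hΩB : inner ℝ (Ω : PhysSpace) (B : PhysSpace) = e * s := by
    simp only [Ω, inner_smul_left, hwB, hs, conj_trivial]; ring
  refine ⟨Ω, (hp.nonneg Ω A).lt_of_ne' ?_, (hp.nonneg Ω B).lt_of_ne' ?_⟩
  · rw [scatKernel, hΩA]
    exact hroot s hspos.ne' (by rwa [abs_of_pos hspos])
  · rw [scatKernel, hΩB]
    refine hroot _ (mul_ne_zero ?_ hspos.ne') (by rwa [abs_mul, habs, one_mul, abs_of_pos hspos])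
    rintro rfl
    norm_num at he

/-- The overlap of the kernels at two directions. -/
def kernelOverlap (L : ℕ) (C : ℕ → ℝ) (A B : Direction) : ℝ :=
  angInt fun Ω => min (scatKernel L C Ω A) (scatKernel L C Ω B)

lemma continuous_min_scatKernel (A B : Direction) :
    Continuous fun Ω => min (scatKernel L C Ω A) (scatKernel L C Ω B) :=
  (continuous_id.scatKernel continuous_const).min (continuous_id.scatKernel continuous_const)

/-- The overlap is continuous on a compact space, so it attains its minimum, which is positive by
`exists_common_pos`. -/
lemma IsPhaseFunction.exists_overlap_lower_bound (hp : IsPhaseFunction L C) :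
    ∃ κ > 0, ∀ A B, κ ≤ kernelOverlap L C A B := by
  have hcont : Continuous fun q : Direction × Direction => kernelOverlap L C q.1 q.2 :=
    continuous_angInt (f := fun (q : Direction × Direction) Ω =>
        min (scatKernel L C Ω q.1) (scatKernel L C Ω q.2))
      ((continuous_snd.scatKernel (continuous_fst.comp continuous_fst)).min
        (continuous_snd.scatKernel (continuous_snd.comp continuous_fst)))
  obtain ⟨q, -, hq⟩ := isCompact_univ.exists_isMinOn
    ⟨(axisDir 0, axisDir 0), mem_univ _⟩ hcont.continuousOn
  rw [isMinOn_univ_iff] at hq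
  refine ⟨kernelOverlap L C q.1 q.2, ?_, fun A B => hq (A, B)⟩
  obtain ⟨Ω, hA, hB⟩ := hp.exists_common_pos q.1 q.2
  exact angInt_pos (continuous_min_scatKernel _ _)
    (fun Ω => le_min (hp.nonneg _ _) (hp.nonneg _ _)) (lt_min hA hB)

/-- Doeblin's argument: the common part `m` of the two kernels cancels, and each remainder has mass
`1 - kernelOverlap`. -/
lemma IsPhaseFunction.scatSource_sub_le (hp : IsPhaseFunction L C) {f : Direction → ℝ}
    (hf : Continuous f) {a b : ℝ} (ha : ∀ Ω, a ≤ f Ω) (hb : ∀ Ω, f Ω ≤ b) (A B : Direction) :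
    scatSource L C f A - scatSource L C f B ≤ (1 - kernelOverlap L C A B) * (b - a) := by
  have hk (D : Direction) : Continuous fun Ω => scatKernel L C Ω D :=
    continuous_id.scatKernel continuous_const
  have hm := continuous_min_scatKernel (L := L) (C := C) A B
  set m : Direction → ℝ := fun Ω => min (scatKernel L C Ω A) (scatKernel L C Ω B) with hmdef
  have hint (D : Direction) : angInt (fun Ω => scatKernel L C Ω D - m Ω)
      = 1 - kernelOverlap L C A B := by
    rw [angInt_sub (hk D) hm, hp.normalized]
    rfl
  calc scatSource L C f A - scatSource L C f B
      = angInt (fun Ω => scatKernel L C Ω A * f Ω - scatKernel L C Ω B * f Ω) :=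
        (angInt_sub (continuous_scatKernel_mul hf A) (continuous_scatKernel_mul hf B)).symm
    -- Pointwise the gap is `(b - f)(p_A - m) + (f - a)(p_B - m) ≥ 0`.
    _ ≤ angInt (fun Ω => b * (scatKernel L C Ω A - m Ω) - a * (scatKernel L C Ω B - m Ω)) := by
        refine angInt_mono ((continuous_scatKernel_mul hf A).sub (continuous_scatKernel_mul hf B))
          ((continuous_const.mul ((hk A).sub hm)).sub (continuous_const.mul ((hk B).sub hm)))
          fun Ω => ?_
        have h1 : m Ω ≤ scatKernel L C Ω A := min_le_left _ _
        have h2 : m Ω ≤ scatKernel L C Ω B := min_le_right _ _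
        nlinarith [mul_nonneg (sub_nonneg.2 h1) (sub_nonneg.2 (hb Ω)),
          mul_nonneg (sub_nonneg.2 h2) (sub_nonneg.2 (ha Ω))]
    _ = (1 - kernelOverlap L C A B) * (b - a) := by
        have h1 := angInt_sub (f := fun Ω => b * (scatKernel L C Ω A - m Ω))
          (g := fun Ω => a * (scatKernel L C Ω B - m Ω))
          (continuous_const.mul ((hk A).sub hm)) (continuous_const.mul ((hk B).sub hm))
        rw [h1, angInt_const_mul, angInt_const_mul, hint, hint]
        ring

/-- The oscillation of `f` is controlled by the size of `f - S`. -/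
lemma IsPhaseFunction.exists_oscillation_bound (hp : IsPhaseFunction L C) :
    ∃ M : ℝ, 0 ≤ M ∧ ∀ (f : Direction → ℝ) (η : ℝ), Continuous f →
      (∀ Ω, |f Ω - scatSource L C f Ω| ≤ η) → ∀ A B, |f A - f B| ≤ M * η := by
  obtain ⟨κ, hκ, hoverlap⟩ := hp.exists_overlap_lower_bound
  refine ⟨2 / κ, by positivity, fun f η hf hη => ?_⟩
  obtain ⟨P, -, hP⟩ := isCompact_univ.exists_isMaxOn ⟨axisDir 0, mem_univ _⟩ hf.continuousOn
  obtain ⟨N, -, hN⟩ := isCompact_univ.exists_isMinOn ⟨axisDir 0, mem_univ _⟩ hf.continuousOn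
  have hP' (Ω : Direction) : f Ω ≤ f P := hP (mem_univ Ω)
  have hN' (Ω : Direction) : f N ≤ f Ω := hN (mem_univ Ω)
  have h1 := hp.scatSource_sub_le hf hN' hP' P N
  have h2 := (abs_le.1 (hη P)).2
  have h3 := (abs_le.1 (hη N)).1
  -- From `f P - f N ≤ 2 η + (S f P - S f N)` and the contraction by `1 - κ`.
  have h4 : κ * (f P - f N) ≤ 2 * η := by
    nlinarith [mul_le_mul_of_nonneg_right (hoverlap P N) (sub_nonneg.2 (hN' P))]
  have h5 : f P - f N ≤ 2 / κ * η := by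
    rw [div_mul_eq_mul_div, le_div_iff₀ hκ]; linarith
  intro A B
  rw [abs_le]
  constructor <;> linarith [hP' A, hP' B, hN' A, hN' B]

/-- If `γ` were `1`, then `μ` would be fixed by scattering and hence constant by the oscillation
bound. -/
lemma IsPhaseFunction.exists_scatSource_dirCos (hp : IsPhaseFunction L C) :
    ∃ γ : ℝ, γ ≠ 1 ∧ ∀ k Ω, scatSource L C (dirCos k) Ω = γ * dirCos k Ω := by
  obtain ⟨γ, hγ⟩ := _root_.exists_scatSource_dirCos (L := L) (C := C)
  refine ⟨γ, ?_, hγ⟩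
  rintro rfl
  obtain ⟨M, -, hM⟩ := hp.exists_oscillation_bound
  have := hM (dirCos 0) 0 (continuous_dirCos 0) (fun Ω => by simp [hγ]) (axisDir 0) (axisDir 1)
  simp [dirCos, axisDir] at this
  norm_num at this

/-- If `f - S` is close to a linear function of the direction, then `f` is close to an affine
one. -/
lemma IsPhaseFunction.exists_affine_approx (hp : IsPhaseFunction L C) :
    ∃ M : ℝ, 0 ≤ M ∧ ∀ (f : Direction → ℝ) (η : ℝ) (v : Fin 3 → ℝ), Continuous f →
      (∀ Ω, |f Ω - scatSource L C f Ω - ∑ k, v k * dirCos k Ω| ≤ η) →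
        ∃ (β : ℝ) (b : Fin 3 → ℝ), ∀ Ω, |f Ω - (β + ∑ k, b k * dirCos k Ω)| ≤ M * η := by
  obtain ⟨M, hM0, hM⟩ := hp.exists_oscillation_bound
  obtain ⟨γ, hγ1, hγ⟩ := hp.exists_scatSource_dirCos
  refine ⟨M, hM0, fun f η v hf hη => ?_⟩
  -- The linear function `b · Ω` solves `g - S g = v · Ω`; what remains of `f` has small
  -- oscillation, and any of its values can serve as `β`.
  set b : Fin 3 → ℝ := fun k => v k / (1 - γ) with hb
  have hterm (k : Fin 3) : Continuous fun Ω => b k * dirCos k Ω :=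
    continuous_const.mul (continuous_dirCos k)
  have hlin : Continuous fun Ω => ∑ k, b k * dirCos k Ω :=
    continuous_finsetSum _ fun k _ => hterm k
  have hsource (Ω : Direction) : scatSource L C (fun Ω => f Ω - ∑ k, b k * dirCos k Ω) Ω
      = scatSource L C f Ω - γ * ∑ k, b k * dirCos k Ω := by
    rw [scatSource_sub hf hlin, scatSource_sum _ fun k _ => hterm k, Finset.mul_sum]
    congr 1
    exact Finset.sum_congr rfl fun k _ => by rw [scatSource_const_mul, hγ]; ring
  have hv (Ω : Direction) : (1 - γ) * ∑ k, b k * dirCos k Ω = ∑ k, v k * dirCos k Ω := by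
    rw [Finset.mul_sum]
    refine Finset.sum_congr rfl fun k _ => ?_
    rw [hb, ← mul_assoc, mul_div_cancel₀ _ (sub_ne_zero.2 hγ1.symm)]
  have hosc := hM (fun Ω => f Ω - ∑ k, b k * dirCos k Ω) η (hf.sub hlin) fun Ω => by
    rw [hsource]
    convert hη Ω using 2
    rw [← hv]; ring
  refine ⟨f (axisDir 0) - ∑ k, b k * dirCos k (axisDir 0), b, fun Ω => ?_⟩
  convert hosc Ω (axisDir 0) using 2
  ring

/-! ### Moments of affine functions of the direction. -/

lemma angMoment_add {l : ℕ} (i : Fin l → Fin 3) {f g : Direction → ℝ} (hf : Continuous f)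
    (hg : Continuous g) :
    angMoment i (fun Ω => f Ω + g Ω) = angMoment i f + angMoment i g := by
  simp only [angMoment, mul_add]
  exact angInt_add ((continuous_dirProd i).mul hf) ((continuous_dirProd i).mul hg)

lemma angMoment_sub {l : ℕ} (i : Fin l → Fin 3) {f g : Direction → ℝ} (hf : Continuous f)
    (hg : Continuous g) :
    angMoment i (fun Ω => f Ω - g Ω) = angMoment i f - angMoment i g := by
  simp only [angMoment, mul_sub]
  exact angInt_sub ((continuous_dirProd i).mul hf) ((continuous_dirProd i).mul hg)

lemma angMoment_const_mul {l : ℕ} (i : Fin l → Fin 3) (a : ℝ) (f : Direction → ℝ) :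
    angMoment i (fun Ω => a * f Ω) = a * angMoment i f := by
  simp only [angMoment, mul_left_comm _ a]
  exact angInt_const_mul a _

lemma angMoment_sum {ι : Type*} (s : Finset ι) {l : ℕ} (i : Fin l → Fin 3)
    {f : ι → Direction → ℝ} (hf : ∀ k ∈ s, Continuous (f k)) :
    angMoment i (fun Ω => ∑ k ∈ s, f k Ω) = ∑ k ∈ s, angMoment i (f k) := by
  simp only [angMoment, Finset.mul_sum]
  exact angInt_sum s fun k hk => (continuous_dirProd i).mul (hf k hk)

lemma angMoment_const {l : ℕ} (i : Fin l → Fin 3) (a : ℝ) :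
    angMoment i (fun _ => a) = a * angInt (dirProd i) := by
  simp only [angMoment, mul_comm _ a]
  exact angInt_const_mul a _

lemma angMoment_dirCos {l : ℕ} (i : Fin l → Fin 3) (k : Fin 3) :
    angMoment i (dirCos k) = angInt fun Ω => dirCos k Ω * dirProd i Ω := by
  simp only [angMoment, mul_comm]

lemma abs_angMoment_le {l : ℕ} (i : Fin l → Fin 3) {f : Direction → ℝ} {η : ℝ}
    (h : ∀ Ω, |f Ω| ≤ η) : |angMoment i f| ≤ η * sphereArea := by
  refine abs_angInt_le fun Ω => ?_
  rw [abs_mul]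
  calc |dirProd i Ω| * |f Ω| ≤ 1 * |f Ω| := by gcongr; exact abs_dirProd_le_one i Ω
    _ ≤ η := by rw [one_mul]; exact h Ω

lemma continuous_affine (β : ℝ) (b : Fin 3 → ℝ) :
    Continuous fun Ω : Direction => β + ∑ k, b k * dirCos k Ω :=
  continuous_const.add <|
    continuous_finsetSum _ fun k _ => continuous_const.mul (continuous_dirCos k)

lemma angMoment_affine {l : ℕ} {i : Fin l → Fin 3} {j : Fin 3} (h : Odd (idxCount i j))
    (β : ℝ) (b : Fin 3 → ℝ) :
    angMoment i (fun Ω => β + ∑ k, b k * dirCos k Ω)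
      = b j * angInt fun Ω => dirCos j Ω * dirProd i Ω := by
  have hterm (k : Fin 3) : Continuous fun Ω => b k * dirCos k Ω :=
    continuous_const.mul (continuous_dirCos k)
  rw [angMoment_add i continuous_const (continuous_finsetSum _ fun k _ => hterm k),
    angMoment_const, angInt_dirProd_eq_zero h, angMoment_sum _ i fun k _ => hterm k, mul_zero,
    zero_add, Finset.sum_eq_single j]
  · rw [angMoment_const_mul, angMoment_dirCos]
  · intro k _ hk
    rw [angMoment_const_mul, angMoment_dirCos, angInt_dirCos_mul_dirProd_eq_zero hk h, mul_zero]
  · simp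

/-- The odd moments of an almost affine function almost satisfy the relations. -/
lemma exists_oddMomentRelations_of_affine :
    ∃ M : ℝ, 0 ≤ M ∧ ∀ (f : Direction → ℝ) (η β : ℝ) (b : Fin 3 → ℝ), Continuous f →
      (∀ Ω, |f Ω - (β + ∑ k, b k * dirCos k Ω)| ≤ η) →
        OddMomentRelations (fun x y => |x - y| ≤ M * η) f := by
  set q := angInt fun Ω => dirCos 0 Ω ^ 2 with hq
  have hqpos : 0 < q := angInt_dirCos_zero_sq_pos
  have hm := sphereArea_nonneg
  -- The first term is the error of the `l`-th moment, the second that of `J_j` times the largest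
  -- possible coefficient.
  refine ⟨sphereArea + sphereArea / q * sphereArea, by positivity, fun f η β b hf hη => ?_⟩
  have hη0 : 0 ≤ η := (abs_nonneg _).trans (hη (axisDir 0))
  have hr (l : ℕ) (i : Fin l → Fin 3) (j : Fin 3) (h : Odd (idxCount i j)) :
      |angMoment i f - b j * angInt (fun Ω => dirCos j Ω * dirProd i Ω)| ≤ η * sphereArea := by
    rw [← angMoment_affine h β b, ← angMoment_sub i hf (continuous_affine β b)]
    exact abs_angMoment_le i hη
  have hfirst (j : Fin 3) : |angMoment ![j] f - b j * q| ≤ η * sphereArea := by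
    have h := hr 1 ![j] j (by simp [idxCount])
    rw [hq, ← angInt_dirCos_sq j]
    simpa [dirProd, sq] using h
  have hcoef (l : ℕ) (i : Fin l → Fin 3) (j : Fin 3) :
      |angInt (fun Ω => dirCos j Ω * dirProd i Ω)| ≤ sphereArea := by
    simpa using abs_angInt_le (η := 1) (f := fun Ω => dirCos j Ω * dirProd i Ω) fun Ω => by
      rw [dirCos_mul_dirProd]; exact abs_dirProd_le_one _ Ω
  have hmain (l : ℕ) (i : Fin l → Fin 3) (j : Fin 3) (h : Odd (idxCount i j)) :
      |angMoment i f - angInt (fun Ω => dirCos j Ω * dirProd i Ω) / q * angMoment ![j] f|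
        ≤ (sphereArea + sphereArea / q * sphereArea) * η := by
    set B := angInt (fun Ω => dirCos j Ω * dirProd i Ω) with hB
    have h1 : angMoment i f - B / q * angMoment ![j] f
        = (angMoment i f - b j * B) - B / q * (angMoment ![j] f - b j * q) := by
      field_simp; ring
    rw [h1]
    calc _ ≤ |angMoment i f - b j * B| + |B / q * (angMoment ![j] f - b j * q)| := abs_sub _ _
      _ ≤ η * sphereArea + sphereArea / q * (η * sphereArea) := by
          rw [abs_mul, abs_div, abs_of_pos hqpos]
          gcongr
          · exact hr l i j h
          · exact hcoef l i j
          · exact hfirst j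
      _ = _ := by ring
  refine fun l i _ => ⟨fun h => hmain l i 0 h.1, fun h => hmain l i 1 h.2.1,
    fun h => hmain l i 2 h.2.2, fun h => ?_⟩
  -- When all three counts are odd, the coefficient of `b 0` vanishes as well, since `y` still
  -- occurs an odd number of times.
  have h1 := hr l i 0 h.1
  rw [angInt_dirCos_mul_dirProd_eq_zero (by decide : (0 : Fin 3) ≠ 1) h.2.1, mul_zero] at h1
  refine h1.trans ?_
  rw [mul_comm]
  gcongr
  have : 0 ≤ sphereArea / q * sphereArea := by positivity
  linarith

lemma OddMomentRelations.mono {R R' : ℝ → ℝ → Prop} (h : ∀ x y, R x y → R' x y)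
    {f : Direction → ℝ} (hf : OddMomentRelations R f) : OddMomentRelations R' f :=
  fun l i hl => ⟨fun hi => h _ _ ((hf l i hl).1 hi), fun hi => h _ _ ((hf l i hl).2.1 hi),
    fun hi => h _ _ ((hf l i hl).2.2.1 hi), fun hi => h _ _ ((hf l i hl).2.2.2 hi)⟩

/-! ### Moments determine a continuous function. -/

/-- The direction cosine as a bundled continuous function. -/
def dirCosMap (k : Fin 3) : C(Direction, ℝ) := ⟨dirCos k, continuous_dirCos k⟩

/-- Multiplying by `Ω_k` only shifts a moment to the next order. Quantifying over `u` after `g` lets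
the product case of the induction apply one hypothesis to `g' u`. -/
lemma angMoment_mul_eq_zero_of_mem_adjoin {g : C(Direction, ℝ)}
    (hg : g ∈ Algebra.adjoin ℝ (range dirCosMap)) :
    ∀ u : Direction → ℝ, Continuous u → (∀ (l : ℕ) (i : Fin l → Fin 3), angMoment i u = 0) →
      ∀ (l : ℕ) (i : Fin l → Fin 3), angMoment i (fun Ω => g Ω * u Ω) = 0 := by
  induction hg using Algebra.adjoin_induction with
  | mem g hg =>
    obtain ⟨k, rfl⟩ := hg
    intro u _ h l i
    rw [← h (l + 1) (Fin.cons k i)]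
    unfold angMoment
    congr 1
    ext Ω
    rw [← dirCos_mul_dirProd]
    simp only [dirCosMap, ContinuousMap.coe_mk]
    ring
  | algebraMap r =>
    intro u _ h l i
    simpa [h l i] using angMoment_const_mul i r u
  | add g g' _ _ hg hg' =>
    intro u hu h l i
    have hsum := angMoment_add i (f := fun Ω => g Ω * u Ω) (g := fun Ω => g' Ω * u Ω)
      (g.continuous.mul hu) (g'.continuous.mul hu)
    rw [hg u hu h, hg' u hu h, add_zero] at hsum
    simpa only [ContinuousMap.add_apply, add_mul] using hsum
  | mul g g' _ _ hg hg' =>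
    intro u hu h l i
    simp only [ContinuousMap.mul_apply, mul_assoc]
    exact hg _ (g'.continuous.mul hu) (hg' u hu h) l i

/-- A continuous function on the sphere is determined by its moments. -/
lemma eq_zero_of_angMoment_eq_zero {u : Direction → ℝ} (hu : Continuous u)
    (h : ∀ (l : ℕ) (i : Fin l → Fin 3), angMoment i u = 0) (Ω : Direction) : u Ω = 0 := by
  have hsep : (Algebra.adjoin ℝ (range dirCosMap)).SeparatesPoints := by
    intro Ω₁ Ω₂ hne
    obtain ⟨k, hk⟩ : ∃ k, dirCos k Ω₁ ≠ dirCos k Ω₂ := by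
      by_contra! hall
      exact hne (Subtype.ext (PiLp.ext hall))
    exact ⟨dirCos k, ⟨dirCosMap k, Algebra.subset_adjoin ⟨k, rfl⟩, rfl⟩, hk⟩
  obtain ⟨B, hB⟩ : ∃ B, ∀ Ω, |u Ω| ≤ B := by
    obtain ⟨B, hB⟩ := isCompact_univ.exists_bound_of_continuousOn hu.continuousOn
    exact ⟨B, fun Ω => hB Ω (mem_univ Ω)⟩
  have hB0 : 0 ≤ B := (abs_nonneg _).trans (hB Ω)
  -- By Stone-Weierstrass a polynomial `g` is `δ`-close to `u`; as `⟨g u⟩ = 0`, one has `⟨u²⟩ = ⟨(u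
  -- - g) u⟩`.
  have hsmall (δ : ℝ) (hδ : 0 < δ) : angInt (fun Ω => u Ω * u Ω) ≤ δ * B * sphereArea := by
    obtain ⟨⟨g, hgA⟩, hg⟩ :=
      ContinuousMap.exists_mem_subalgebra_near_continuous_of_separatesPoints
        (Algebra.adjoin ℝ (range dirCosMap)) hsep u hu δ hδ
    have h0 : angInt (fun Ω => g Ω * u Ω) = 0 := by
      simpa [angMoment, dirProd] using
        angMoment_mul_eq_zero_of_mem_adjoin hgA u hu h 0 Fin.elim0
    have h1 : angInt (fun Ω => u Ω * u Ω) = angInt (fun Ω => (u Ω - g Ω) * u Ω) := by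
      have h2 := angInt_sub (f := fun Ω => u Ω * u Ω) (g := fun Ω => g Ω * u Ω)
        (hu.mul hu) (g.continuous.mul hu)
      rw [h0, sub_zero] at h2
      simp only [sub_mul, h2]
    rw [h1]
    refine (le_abs_self _).trans (abs_angInt_le fun Ω => ?_)
    rw [abs_mul]
    have h2 : |u Ω - g Ω| ≤ δ := by
      rw [abs_sub_comm]; exact (hg Ω).le
    gcongr
    exact hB Ω
  by_contra hne
  have hpos : 0 < angInt fun Ω => u Ω * u Ω :=
    angInt_pos (hu.mul hu) (fun Ω => mul_self_nonneg _) (mul_self_pos.2 hne)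
  have h1 : (0 : ℝ) < B * sphereArea + 1 := by have := sphereArea_nonneg; positivity
  have h2 := hsmall _ (div_pos hpos h1)
  rw [mul_assoc, div_mul_eq_mul_div, le_div_iff₀ h1] at h2
  linarith

/-! ### The exact closure, part (b). -/

/-- The antipodal direction. -/
def antipode (Ω : Direction) : Direction := rotate (LinearIsometryEquiv.neg ℝ) Ω

lemma continuous_antipode : Continuous antipode := continuous_rotate _

lemma dirCos_antipode (k : Fin 3) (Ω : Direction) : dirCos k (antipode Ω) = -dirCos k Ω := by
  simp [dirCos, antipode]

lemma dirProd_antipode {l : ℕ} (i : Fin l → Fin 3) (Ω : Direction) :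
    dirProd i (antipode Ω) = (-1) ^ l * dirProd i Ω := by
  simp only [dirProd, dirCos_antipode]
  rw [Finset.prod_neg, Finset.card_univ, Fintype.card_fin]

lemma angMoment_antipode {l : ℕ} (i : Fin l → Fin 3) (f : Direction → ℝ) :
    angMoment i (fun Ω => f (antipode Ω)) = (-1) ^ l * angMoment i f := by
  have h1 := angInt_rotate (LinearIsometryEquiv.neg ℝ) fun Ω => dirProd i Ω * f Ω
  have h2 : angInt (fun Ω => dirProd i (antipode Ω) * f (antipode Ω)) = angMoment i f := h1
  simp only [dirProd_antipode, mul_assoc] at h2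
  rw [angInt_const_mul] at h2
  rw [← h2, ← mul_assoc, ← mul_pow, neg_one_mul, neg_neg, one_pow, one_mul]
  rfl

lemma scatSource_antipode (f : Direction → ℝ) (Ω : Direction) :
    scatSource L C f (antipode Ω) = scatSource L C (fun Ω => f (antipode Ω)) Ω :=
  scatSource_rotate _ f Ω

/-- If the even moments of `f` and of its scattering source agree, then the even part of `f` is
isotropic. -/
lemma IsPhaseFunction.even_part_isotropic (hp : IsPhaseFunction L C) {f : Direction → ℝ}
    (hf : Continuous f)
    (h : ∀ (m : ℕ) (i : Fin m → Fin 3), Even m →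
      angMoment i f = angMoment i (scatSource L C f)) (A B : Direction) :
    f A + f (antipode A) = f B + f (antipode B) := by
  have hS := continuous_scatSource (L := L) (C := C) hf
  have hfa : Continuous fun Ω => f (antipode Ω) := hf.comp continuous_antipode
  have hdiff : Continuous fun Ω => f Ω - scatSource L C f Ω := hf.sub hS
  have hdiffa : Continuous fun Ω => f (antipode Ω) - scatSource L C f (antipode Ω) :=
    hdiff.comp continuous_antipode
  -- Symmetrisation kills the odd moments of `f - S f`, and the hypothesis kills the even ones. So
  -- the even part of `f` is fixed by scattering.
  have hfix (Ω : Direction) : (f Ω - scatSource L C f Ω)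
      + (f (antipode Ω) - scatSource L C f (antipode Ω)) = 0 := by
    refine eq_zero_of_angMoment_eq_zero
      (u := fun Ω => (f Ω - scatSource L C f Ω)
        + (f (antipode Ω) - scatSource L C f (antipode Ω)))
      (hdiff.add hdiffa) (fun l i => ?_) Ω
    rw [angMoment_add i hdiff hdiffa,
      angMoment_antipode i fun Ω => f Ω - scatSource L C f Ω, angMoment_sub i hf hS]
    rcases Nat.even_or_odd l with hl | hl
    · rw [h l i hl]; ring
    · rw [hl.neg_one_pow]; ring
  obtain ⟨M, -, hM⟩ := hp.exists_oscillation_bound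
  have h1 := hM (fun Ω => f Ω + f (antipode Ω)) 0 (hf.add hfa) (fun Ω => by
    rw [scatSource_add hf hfa, ← scatSource_antipode, abs_nonpos_iff]
    linarith [hfix Ω]) A B
  rw [mul_zero, abs_nonpos_iff] at h1
  linarith

lemma RegularIntensity.continuous {k : ℕ} {U : Set SpaceTime} {f : SpaceTime → Direction → ℝ}
    (hf : RegularIntensity k U f) {z : SpaceTime} (hz : z ∈ U) : Continuous (f z) := by
  have h1 := hf.continuousOn 0 (Nat.zero_le _)
  have h2 : Continuous fun Ω : Direction => iteratedFDeriv ℝ 0 (fun z => f z Ω) z :=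
    h1.comp_continuous (f := fun Ω : Direction => (z, Ω)) (by fun_prop)
      fun Ω => ⟨hz, mem_univ _⟩
  have h3 : Continuous fun Ω : Direction => iteratedFDeriv ℝ 0 (fun z => f z Ω) z 0 :=
    (continuous_eval_const _).comp h2
  simpa using h3

lemma spacePartial_congr {k : Fin 3} {F G : SpaceTime → ℝ} {U : Set SpaceTime} (hU : IsOpen U)
    {z : SpaceTime} (hz : z ∈ U) (h : ∀ w ∈ U, F w = G w) :
    spacePartial k F z = spacePartial k G z := by
  unfold spacePartial
  have h1 : ∀ᶠ y in nhds z.2, (z.1, y) ∈ U :=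
    (Continuous.prodMk_right z.1).continuousAt.eventually_mem (hU.mem_nhds hz)
  have h2 : (fun y => F (z.1, y)) =ᶠ[nhds z.2] fun y => G (z.1, y) := h1.mono fun y hy => h _ hy
  rw [h2.fderiv_eq]

/-- No differentiability is needed: a nonzero factor preserves non-differentiability, where `fderiv`
is `0`, and a zero factor makes both sides `0`. -/
lemma spacePartial_const_mul (k : Fin 3) (a : ℝ) (F : SpaceTime → ℝ) (z : SpaceTime) :
    spacePartial k (fun w => a * F w) z = a * spacePartial k F z := by
  unfold spacePartial
  have h := congrFun (fderiv_const_smul_field (𝕜 := ℝ) (f := fun y => F (z.1, y)) a) z.2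
  exact congrArg (fun D => D (EuclideanSpace.single k 1)) h

/-- Under the asymptotic closure the odd moments satisfy the relations exactly. -/
lemma SatisfiesClosure.oddMomentRelations (hp : IsPhaseFunction L C) {U : Set SpaceTime}
    (hU : IsOpen U) {σ : SpaceTime → ℝ} {ε : ℝ} {I : SpaceTime → Direction → ℝ}
    {r : ℕ} (hreg : RegularIntensity r U I) (hcl : SatisfiesClosure L C σ ε U I)
    {z : SpaceTime} (hz : z ∈ U) : OddMomentRelations (fun a b => a = b) (I z) := by
  set a : SpaceTime → ℝ := fun w => (I w (axisDir 0) + I w (antipode (axisDir 0))) / 2 with ha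
  have hiso (w : SpaceTime) (hw : w ∈ U) (Ω : Direction) :
      I w Ω + I w (antipode Ω) = 2 * a w := by
    rw [hp.even_part_isotropic (hreg.continuous hw) (fun m i hm => hcl.even m i hm w hw) Ω
      (axisDir 0), ha]
    ring
  -- Even moments see only the even part `a w`, so the divergence in the closure reduces to `∂_k a`
  -- times constants.
  have heven (m : ℕ) (i : Fin m → Fin 3) (hm : Even m) (w : SpaceTime) (hw : w ∈ U) :
      angMoment i (scatSource L C (I w)) = angInt (dirProd i) * a w := by
    have hc := hreg.continuous hw
    rw [← hcl.even m i hm w hw]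
    have h1 := angMoment_add i hc (hc.comp continuous_antipode)
    simp only [Function.comp_apply, hiso w hw] at h1
    rw [angMoment_const, Function.comp_def, angMoment_antipode i (I w), hm.neg_one_pow] at h1
    linarith
  -- These coefficients make `d · Ω` have the same moments as `I - S`: the odd ones by the closure,
  -- the even ones because both vanish.
  set d : Fin 3 → ℝ := fun k => -(ε * (1 / σ z) * spacePartial k a z) with hd
  have hf := hreg.continuous hz
  have hS := continuous_scatSource (L := L) (C := C) hf
  have hterm (k : Fin 3) : Continuous fun Ω => d k * dirCos k Ω :=
    continuous_const.mul (continuous_dirCos k)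
  have hlin : Continuous fun Ω => ∑ k, d k * dirCos k Ω :=
    continuous_finsetSum _ fun k _ => hterm k
  have hdiff : Continuous fun Ω => I z Ω - scatSource L C (I z) Ω := hf.sub hS
  have hzero (Ω : Direction) : I z Ω - scatSource L C (I z) Ω - ∑ k, d k * dirCos k Ω = 0 := by
    refine eq_zero_of_angMoment_eq_zero
      (u := fun Ω => I z Ω - scatSource L C (I z) Ω - ∑ k, d k * dirCos k Ω)
      (hdiff.sub hlin) (fun l i => ?_) Ω
    rw [angMoment_sub i hdiff hlin, angMoment_sub i hf hS, angMoment_sum _ i fun k _ => hterm k]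
    simp only [angMoment_const_mul, angMoment_dirCos, dirCos_mul_dirProd]
    rcases Nat.even_or_odd l with hl | hl
    · rw [hcl.even l i hl z hz, sub_self, zero_sub, neg_eq_zero]
      refine Finset.sum_eq_zero fun k _ => ?_
      have h1 := angMoment_antipode (Fin.cons k i : Fin (l + 1) → Fin 3) fun _ => 1
      rw [hl.add_one.neg_one_pow, angMoment_const] at h1
      rw [show angInt (dirProd (Fin.cons k i : Fin (l + 1) → Fin 3)) = 0 by linarith, mul_zero]
    · rw [hcl.odd l i hl z hz]
      have h1 (k : Fin 3) : spacePartial k (fun w =>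
          angMoment (Fin.cons k i : Fin (l + 1) → Fin 3) (scatSource L C (I w))) z
          = angInt (dirProd (Fin.cons k i : Fin (l + 1) → Fin 3)) * spacePartial k a z := by
        rw [spacePartial_congr hU hz fun w hw => heven _ _ hl.add_one w hw,
          spacePartial_const_mul]
      simp only [h1, hd, Fin.sum_univ_three]
      ring
  obtain ⟨M, -, hM⟩ := hp.exists_affine_approx
  obtain ⟨M', -, hM'⟩ := exists_oddMomentRelations_of_affine
  obtain ⟨β, b, hb⟩ := hM (I z) 0 d hf fun Ω => by rw [hzero, abs_zero]
  refine (hM' (I z) _ β b hf hb).mono fun x y hxy => ?_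
  rwa [mul_zero, mul_zero, abs_nonpos_iff, sub_eq_zero] at hxy

/-! ### Derivatives and the transport equation. -/

/-- The spatial coordinate vector of space-time. -/
def spaceVec (k : Fin 3) : SpaceTime := (0, EuclideanSpace.single k 1)

lemma norm_spaceVec (k : Fin 3) : ‖spaceVec k‖ = 1 := by
  simp [spaceVec, Prod.norm_def]

lemma spacePartial_eq_fderiv {k : Fin 3} {F : SpaceTime → ℝ} {z : SpaceTime}
    (hF : DifferentiableAt ℝ F z) : spacePartial k F z = fderiv ℝ F z (spaceVec k) := by
  have h := hF.hasFDerivAt.comp (f := fun y : PhysSpace => (z.1, y)) z.2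
    (hasFDerivAt_prodMk_right z.1 z.2)
  unfold spacePartial
  rw [show (fun y => F (z.1, y)) = F ∘ fun y : PhysSpace => (z.1, y) from rfl, h.fderiv]
  simp [spaceVec]

lemma timePartial_eq_fderiv {F : SpaceTime → ℝ} {z : SpaceTime}
    (hF : DifferentiableAt ℝ F z) : timePartial F z = fderiv ℝ F z (1, 0) := by
  have h := hF.hasFDerivAt.comp (f := fun t : ℝ => (t, z.2)) z.1
    (hasFDerivAt_prodMk_left z.1 z.2)
  unfold timePartial
  rw [← fderiv_apply_one_eq_deriv,
    show (fun t => F (t, z.2)) = F ∘ fun t : ℝ => (t, z.2) from rfl, h.fderiv]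
  simp

lemma sum_dirCos_mul_apply_spaceVec (D : SpaceTime →L[ℝ] ℝ) (Ω : Direction) :
    ∑ k, dirCos k Ω * D (spaceVec k) = D (0, (Ω : PhysSpace)) := by
  have h : ((0, (Ω : PhysSpace)) : SpaceTime) = ∑ k, dirCos k Ω • spaceVec k := by
    ext j
    · simp [spaceVec, Prod.fst_sum]
    · simp only [spaceVec, Prod.smul_mk, Fin.sum_univ_three]
      fin_cases j <;> simp [dirCos]
  rw [h, map_sum]
  simp

lemma RegularIntensity.differentiableAt {k : ℕ} {U : Set SpaceTime}
    {f : SpaceTime → Direction → ℝ} (hf : RegularIntensity k U f) (hk : 1 ≤ k) (hU : IsOpen U)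
    {z : SpaceTime} (hz : z ∈ U) (Ω : Direction) : DifferentiableAt ℝ (fun w => f w Ω) z :=
  ((hf.contDiffOn Ω).contDiffAt (hU.mem_nhds hz)).differentiableAt
    (by exact_mod_cast (Nat.one_le_iff_ne_zero.1 hk))

lemma RegularIntensity.continuous_fderiv_apply {k : ℕ} {U : Set SpaceTime}
    {f : SpaceTime → Direction → ℝ} (hf : RegularIntensity k U f) (hk : 1 ≤ k)
    {z : SpaceTime} (hz : z ∈ U) (e : SpaceTime) :
    Continuous fun Ω => fderiv ℝ (fun w => f w Ω) z e := by
  have h2 : Continuous fun Ω : Direction => iteratedFDeriv ℝ 1 (fun z => f z Ω) z :=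
    (hf.continuousOn 1 hk).comp_continuous (f := fun Ω : Direction => (z, Ω)) (by fun_prop)
      fun Ω => ⟨hz, mem_univ _⟩
  have h3 : Continuous fun Ω : Direction => iteratedFDeriv ℝ 1 (fun z => f z Ω) z fun _ => e :=
    (continuous_eval_const _).comp h2
  simpa only [iteratedFDeriv_one_apply] using h3

/-- Differentiation of the scattering source under the integral sign. -/
lemma RegularIntensity.hasDerivAt_scatSource {k : ℕ} {U : Set SpaceTime}
    {f : SpaceTime → Direction → ℝ} (hf : RegularIntensity k U f) (hk : 1 ≤ k) (hU : IsOpen U)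
    {z : SpaceTime} (hz : z ∈ U) (e : SpaceTime) (Ω : Direction) :
    HasDerivAt (fun s : ℝ => scatSource L C (f (z + s • e)) Ω)
      (scatSource L C (fun Ω' => fderiv ℝ (fun w => f w Ω') z e) Ω) 0 := by
  obtain ⟨ρ, hρ, hsub⟩ := Metric.nhds_basis_closedBall.mem_iff.1 (hU.mem_nhds hz)
  obtain ⟨B, hB⟩ := ((isCompact_closedBall z ρ).prod (isCompact_univ (X := Direction)))
    |>.exists_bound_of_continuousOn
      ((hf.continuousOn 1 hk).mono (prod_mono hsub Subset.rfl))
  have hline : Continuous fun s : ℝ => z + s • e := by fun_prop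
  have hball : ∀ᶠ s in nhds (0 : ℝ), z + s • e ∈ Metric.closedBall z ρ := by
    have h0 := hline.continuousAt (x := 0)
    rw [ContinuousAt, zero_smul, add_zero] at h0
    exact h0 (Metric.closedBall_mem_nhds z hρ)
  have h := hasDerivAt_integral_of_dominated_loc_of_deriv_le
    (μ := (volume : Measure PhysSpace).toSphere) (x₀ := (0 : ℝ))
    (s := {s : ℝ | z + s • e ∈ Metric.closedBall z ρ})
    (F := fun s Ω' => scatKernel L C Ω' Ω * f (z + s • e) Ω')
    (F' := fun s Ω' => scatKernel L C Ω' Ω * fderiv ℝ (fun w => f w Ω') (z + s • e) e)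
    (bound := fun Ω' => |scatKernel L C Ω' Ω| * (B * ‖e‖)) hball ?_ ?_ ?_ ?_ ?_ ?_
  · simpa [scatSource, angInt] using h.2
  · filter_upwards [hball] with s hs
    exact (continuous_scatKernel_mul (hf.continuous (hsub hs)) Ω).aestronglyMeasurable
  · exact (continuous_scatKernel_mul (hf.continuous (by simpa using hz)) Ω).integrable_direction
  · exact (continuous_scatKernel_mul
      (hf.continuous_fderiv_apply hk (by simpa using hz) e) Ω).aestronglyMeasurable
  · refine .of_forall fun Ω' s hs => ?_
    rw [norm_mul]
    refine mul_le_mul_of_nonneg_left ?_ (abs_nonneg _)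
    refine (ContinuousLinearMap.le_opNorm _ _).trans ?_
    gcongr
    rw [← norm_iteratedFDeriv_one]
    exact hB (z + s • e, Ω') ⟨hs, mem_univ _⟩
  · exact ((continuous_id.scatKernel continuous_const).abs.mul
      continuous_const).integrable_direction
  · refine .of_forall fun Ω' s hs => ?_
    have h1 := (hf.differentiableAt hk hU (hsub hs) Ω').hasFDerivAt.comp_hasDerivAt s
      (((hasDerivAt_id s).smul_const e).const_add z)
    simpa using h1.const_mul (scatKernel L C Ω' Ω)

/-- The transport equation, solved for `I - S`. -/
lemma SolvesTransport.sub_scatSource_eq {k : ℕ} {U : Set SpaceTime} {σ : SpaceTime → ℝ}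
    {c ε : ℝ} {f : SpaceTime → Direction → ℝ} (h : SolvesTransport L C c σ ε U f)
    (hf : RegularIntensity k U f) (hk : 1 ≤ k) (hU : IsOpen U) (hc : 0 < c) (hε : 0 < ε)
    {z : SpaceTime} (hz : z ∈ U) (hσ : 0 < σ z) (Ω : Direction) :
    f z Ω - scatSource L C (f z) Ω
      = (σ z)⁻¹ * fderiv ℝ (fun w => f w Ω) z (-(ε ^ 2 / c), -ε • (Ω : PhysSpace)) := by
  have hd := hf.differentiableAt hk hU hz Ω
  have h1 := h z hz Ω
  rw [timePartial_eq_fderiv hd] at h1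
  simp only [spacePartial_eq_fderiv hd] at h1
  rw [sum_dirCos_mul_apply_spaceVec] at h1
  have h2 : ((-(ε ^ 2 / c), -ε • (Ω : PhysSpace)) : SpaceTime)
      = (-(ε ^ 2 / c)) • ((1, 0) : SpaceTime) + (-ε) • ((0, (Ω : PhysSpace)) : SpaceTime) := by
    simp
  rw [h2, map_add, map_smul, map_smul, smul_eq_mul, smul_eq_mul]
  have hσ' := hσ.ne'
  field_simp at h1 ⊢
  linarith

lemma norm_transportVec_le {c ε ε₀ : ℝ} (hc : 0 < c) (hε : ε ∈ Ioo 0 ε₀) (Ω : Direction) :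
    ‖((-(ε ^ 2 / c), -ε • (Ω : PhysSpace)) : SpaceTime)‖ ≤ (1 + ε₀ / c) * ε := by
  have hε0 := hε.1
  have hε1 := hε.2
  have hpos : 0 < ε₀ / c := div_pos (hε0.trans hε1) hc
  rw [Prod.norm_def, norm_smul, norm_eq_of_mem_sphere, norm_neg, norm_neg, Real.norm_eq_abs,
    Real.norm_eq_abs, abs_of_pos hε0, abs_of_pos (by positivity)]
  refine max_le ?_ (by nlinarith)
  have h1 : ε ^ 2 / c = ε / c * ε := by ring
  rw [h1]
  have h2 : ε / c ≤ ε₀ / c := by gcongr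
  nlinarith

/-! ### The optically thick regime, part (a). -/

section ThickRegime

variable {c ε₀ : ℝ} {σ : SpaceTime → ℝ} {U : Set SpaceTime} {I : ℝ → SpaceTime → Direction → ℝ}

lemma IsThickFamily.exists_fderiv_bounds (hI : IsThickFamily L C c σ ε₀ U I) {K : Set SpaceTime}
    (hKU : K ⊆ U) (hK : IsCompact K) :
    ∃ B : ℝ, 0 ≤ B ∧ ∀ ε ∈ Ioo 0 ε₀, ∀ z ∈ K, ∀ Ω,
      ‖fderiv ℝ (fun w => I ε w Ω) z‖ ≤ B ∧
        ‖fderiv ℝ (fderiv ℝ fun w => I ε w Ω) z‖ ≤ B := by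
  obtain ⟨B, hB⟩ := hI.bounded K hKU hK
  refine ⟨|B|, abs_nonneg B, fun ε hε z hz Ω => ⟨?_, ?_⟩⟩
  · rw [← norm_iteratedFDeriv_one]
    exact (hB ε hε z hz Ω 1 (by norm_num)).trans (le_abs_self B)
  · rw [← norm_iteratedFDeriv_one, norm_iteratedFDeriv_fderiv]
    exact (hB ε hε z hz Ω 2 le_rfl).trans (le_abs_self B)

/-- The gradient of `1/σ` enters because the equation for `I - S` is itself differentiated in space.
-/
lemma exists_inv_bounds (hU : IsOpen U) (hσ : ContDiffOn ℝ 1 σ U) (hσ_pos : ∀ z ∈ U, 0 < σ z)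
    {K : Set SpaceTime} (hKU : K ⊆ U) (hK : IsCompact K) :
    ∃ B : ℝ, 0 ≤ B ∧ ∀ z ∈ K, |(σ z)⁻¹| ≤ B ∧ ‖fderiv ℝ (fun w => (σ w)⁻¹) z‖ ≤ B := by
  have hinv : ContDiffOn ℝ 1 (fun w => (σ w)⁻¹) U := hσ.inv fun z hz => (hσ_pos z hz).ne'
  obtain ⟨B₁, hB₁⟩ := hK.exists_bound_of_continuousOn (hinv.continuousOn.mono hKU)
  obtain ⟨B₂, hB₂⟩ := hK.exists_bound_of_continuousOn
    ((hinv.continuousOn_fderiv_of_isOpen hU le_rfl).mono hKU)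
  exact ⟨max |B₁| |B₂|, (abs_nonneg B₁).trans (le_max_left _ _), fun z hz =>
    ⟨(hB₁ z hz).trans ((le_abs_self _).trans (le_max_left _ _)),
      (hB₂ z hz).trans ((le_abs_self _).trans (le_max_right _ _))⟩⟩

/-- In the thick regime the spatial gradient is isotropic up to `O(ε)`. -/
lemma IsThickFamily.exists_gradient_oscillation_bound (hI : IsThickFamily L C c σ ε₀ U I)
    (hp : IsPhaseFunction L C) (hU : IsOpen U) (hσ : ContDiffOn ℝ 1 σ U)
    (hσ_pos : ∀ z ∈ U, 0 < σ z) (hc : 0 < c) {K : Set SpaceTime} (hKU : K ⊆ U)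
    (hK : IsCompact K) :
    ∃ M : ℝ, ∀ ε ∈ Ioo 0 ε₀, ∀ z ∈ K, ∀ k A B,
      |fderiv ℝ (fun w => I ε w A) z (spaceVec k) - fderiv ℝ (fun w => I ε w B) z (spaceVec k)|
        ≤ M * ε := by
  obtain ⟨B₁, hB₁0, hB₁⟩ := hI.exists_fderiv_bounds hKU hK
  obtain ⟨B₂, hB₂0, hB₂⟩ := exists_inv_bounds hU hσ hσ_pos hKU hK
  obtain ⟨M, hM0, hM⟩ := hp.exists_oscillation_bound
  refine ⟨M * (2 * (B₂ * (B₁ * (1 + ε₀ / c)))), fun ε hε z hz k => ?_⟩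
  have hzU := hKU hz
  have hreg := hI.regular ε hε
  rw [mul_assoc]
  refine hM (fun Ω => fderiv ℝ (fun w => I ε w Ω) z (spaceVec k)) _
    (hreg.continuous_fderiv_apply one_le_two hzU _) fun Ω => ?_
  set F : SpaceTime → ℝ := fun w => I ε w Ω with hF
  set V : SpaceTime := (-(ε ^ 2 / c), -ε • (Ω : PhysSpace)) with hV
  have hVnorm : ‖V‖ ≤ (1 + ε₀ / c) * ε := norm_transportVec_le hc hε Ω
  have hline : HasDerivAt (fun s : ℝ => z + s • spaceVec k) (spaceVec k) 0 := by
    simpa using ((hasDerivAt_id (0 : ℝ)).smul_const (spaceVec k)).const_add z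
  have hz0 : z + (0 : ℝ) • spaceVec k = z := by simp
  have hlineU : ∀ᶠ s in nhds (0 : ℝ), z + s • spaceVec k ∈ U :=
    hline.continuousAt.eventually_mem (by rw [hz0]; exact hU.mem_nhds hzU)
  -- Both sides of `I - S = σ⁻¹ DI(V)` are differentiated along `x_k`, with `V` constant in `(t,
  -- x)`. Scattering commutes with `∂_k`, so the left side becomes `g - S g` with `g = ∂_k I`; the
  -- right side is `O(ε)` because `V` is.
  have hleft : HasDerivAt (fun s : ℝ => F (z + s • spaceVec k)
        - scatSource L C (I ε (z + s • spaceVec k)) Ω)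
      (fderiv ℝ F z (spaceVec k)
        - scatSource L C (fun Ω' => fderiv ℝ (fun w => I ε w Ω') z (spaceVec k)) Ω) 0 := by
    refine HasDerivAt.sub ?_ (hreg.hasDerivAt_scatSource one_le_two hU hzU _ Ω)
    refine HasFDerivAt.comp_hasDerivAt (l := F) (f := fun s : ℝ => z + s • spaceVec k)
      (0 : ℝ) ?_ hline
    rw [hz0]
    exact (hreg.differentiableAt one_le_two hU hzU Ω).hasFDerivAt
  have hcd : ContDiffAt ℝ 2 F z := (hreg.contDiffOn Ω).contDiffAt (hU.mem_nhds hzU)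
  have hd2 : DifferentiableAt ℝ (fderiv ℝ F) z :=
    (hcd.fderiv_right (m := 1) (by norm_num)).differentiableAt one_ne_zero
  have hinv : DifferentiableAt ℝ (fun w => (σ w)⁻¹) z :=
    ((hσ.contDiffAt (hU.mem_nhds hzU)).differentiableAt one_ne_zero).inv (hσ_pos z hzU).ne'
  have hright : HasDerivAt (fun s : ℝ => (σ (z + s • spaceVec k))⁻¹
        * fderiv ℝ F (z + s • spaceVec k) V)
      (fderiv ℝ (fun w => (σ w)⁻¹) z (spaceVec k) * fderiv ℝ F z V
        + (σ z)⁻¹ * fderiv ℝ (fderiv ℝ F) z (spaceVec k) V) 0 := by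
    have h1 : HasDerivAt (fun s : ℝ => (σ (z + s • spaceVec k))⁻¹)
        (fderiv ℝ (fun w => (σ w)⁻¹) z (spaceVec k)) 0 := by
      refine HasFDerivAt.comp_hasDerivAt (l := fun w => (σ w)⁻¹)
        (f := fun s : ℝ => z + s • spaceVec k) (0 : ℝ) ?_ hline
      rw [hz0]
      exact hinv.hasFDerivAt
    have h2 : HasDerivAt (fun s : ℝ => fderiv ℝ F (z + s • spaceVec k))
        (fderiv ℝ (fderiv ℝ F) z (spaceVec k)) 0 := by
      refine HasFDerivAt.comp_hasDerivAt (l := fderiv ℝ F)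
        (f := fun s : ℝ => z + s • spaceVec k) (0 : ℝ) ?_ hline
      rw [hz0]
      exact hd2.hasFDerivAt
    refine (h1.mul (h2.clm_apply (hasDerivAt_const (0 : ℝ) V))).congr_deriv ?_
    simp
  have heq : (fun s : ℝ => F (z + s • spaceVec k) - scatSource L C (I ε (z + s • spaceVec k)) Ω)
      =ᶠ[nhds 0] fun s : ℝ => (σ (z + s • spaceVec k))⁻¹ * fderiv ℝ F (z + s • spaceVec k) V :=
    hlineU.mono fun s hs => (hI.solves ε hε).sub_scatSource_eq hreg one_le_two hU hc hε.1 hs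
      (hσ_pos _ hs) Ω
  rw [hleft.unique (hright.congr_of_eventuallyEq heq)]
  obtain ⟨hF1, hF2⟩ := hB₁ ε hε z hz Ω
  obtain ⟨hσ1, hσ2⟩ := hB₂ z hz
  have e1 : |fderiv ℝ (fun w => (σ w)⁻¹) z (spaceVec k)| ≤ B₂ := by
    have := (fderiv ℝ (fun w => (σ w)⁻¹) z).le_opNorm (spaceVec k)
    rw [norm_spaceVec, mul_one] at this
    exact this.trans hσ2
  have e2 : |fderiv ℝ F z V| ≤ B₁ * ((1 + ε₀ / c) * ε) :=
    ((fderiv ℝ F z).le_opNorm V).trans (by gcongr)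
  have e3 : |fderiv ℝ (fderiv ℝ F) z (spaceVec k) V| ≤ B₁ * ((1 + ε₀ / c) * ε) := by
    have := (fderiv ℝ (fderiv ℝ F) z).le_opNorm₂ (spaceVec k) V
    rw [norm_spaceVec, mul_one] at this
    exact this.trans (by gcongr)
  calc _ ≤ |fderiv ℝ (fun w => (σ w)⁻¹) z (spaceVec k) * fderiv ℝ F z V|
        + |(σ z)⁻¹ * fderiv ℝ (fderiv ℝ F) z (spaceVec k) V| := abs_add_le _ _
    _ ≤ B₂ * (B₁ * ((1 + ε₀ / c) * ε)) + B₂ * (B₁ * ((1 + ε₀ / c) * ε)) := by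
        rw [abs_mul, abs_mul]
        gcongr
    _ = _ := by ring

/-- In the thick regime the odd moments satisfy the relations up to `O(ε²)`. -/
lemma IsThickFamily.oddMomentRelations (hI : IsThickFamily L C c σ ε₀ U I)
    (hp : IsPhaseFunction L C) (hU : IsOpen U) (hσ : ContDiffOn ℝ 1 σ U)
    (hσ_pos : ∀ z ∈ U, 0 < σ z) (hc : 0 < c) {K : Set SpaceTime} (hKU : K ⊆ U)
    (hK : IsCompact K) :
    ∃ M : ℝ, ∀ ε ∈ Ioo 0 ε₀, ∀ z ∈ K,
      OddMomentRelations (fun a b => |a - b| ≤ M * ε ^ 2) (I ε z) := by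
  obtain ⟨B₁, hB₁0, hB₁⟩ := hI.exists_fderiv_bounds hKU hK
  obtain ⟨B₂, hB₂0, hB₂⟩ := exists_inv_bounds hU hσ hσ_pos hKU hK
  obtain ⟨G, hG⟩ := hI.exists_gradient_oscillation_bound hp hU hσ hσ_pos hc hKU hK
  obtain ⟨M, -, hM⟩ := hp.exists_affine_approx
  obtain ⟨M', -, hM'⟩ := exists_oddMomentRelations_of_affine
  refine ⟨M' * (M * (B₂ * (B₁ / c + 3 * G))), fun ε hε z hz => ?_⟩
  have hzU := hKU hz
  have hε0 := hε.1
  have hreg := hI.regular ε hε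
  set D : Direction → SpaceTime →L[ℝ] ℝ := fun Ω => fderiv ℝ (fun w => I ε w Ω) z with hD
  obtain ⟨β, b, hb⟩ := hM (I ε z) (B₂ * (B₁ / c + 3 * G) * ε ^ 2)
    -- The gradient is frozen at a reference direction. The time derivative costs `ε² B₁ / c`; the
    -- frozen gradient costs `ε` times three components, each off by at most `G ε`.
    (fun k => -(ε * (σ z)⁻¹ * D (axisDir 0) (spaceVec k))) (hreg.continuous hzU) fun Ω => by
    rw [(hI.solves ε hε).sub_scatSource_eq hreg one_le_two hU hc hε0 hzU (hσ_pos z hzU) Ω]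
    have h2 : ((-(ε ^ 2 / c), -ε • (Ω : PhysSpace)) : SpaceTime)
        = (-(ε ^ 2 / c)) • ((1, 0) : SpaceTime) + (-ε) • ((0, (Ω : PhysSpace)) : SpaceTime) := by
      simp
    have h3 : (σ z)⁻¹ * D Ω (-(ε ^ 2 / c), -ε • (Ω : PhysSpace))
          - ∑ k, -(ε * (σ z)⁻¹ * D (axisDir 0) (spaceVec k)) * dirCos k Ω
        = -((σ z)⁻¹ * (ε ^ 2 * (D Ω (1, 0) / c)
            + ε * ∑ k, dirCos k Ω * (D Ω (spaceVec k) - D (axisDir 0) (spaceVec k)))) := by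
      rw [h2, map_add, map_smul, map_smul, ← sum_dirCos_mul_apply_spaceVec]
      simp only [Fin.sum_univ_three, smul_eq_mul]
      ring
    have e1 : |D Ω (1, 0)| ≤ B₁ := by
      have := (D Ω).le_opNorm (1, 0)
      rw [show ‖((1, 0) : SpaceTime)‖ = 1 by simp [Prod.norm_def], mul_one] at this
      exact this.trans (hB₁ ε hε z hz Ω).1
    have e2 : |∑ k, dirCos k Ω * (D Ω (spaceVec k) - D (axisDir 0) (spaceVec k))|
        ≤ 3 * (G * ε) := by
      refine (Finset.abs_sum_le_sum_abs _ _).trans ?_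
      refine (Finset.sum_le_card_nsmul _ _ (G * ε) fun k _ => ?_).trans (by simp)
      rw [abs_mul]
      calc _ ≤ 1 * |D Ω (spaceVec k) - D (axisDir 0) (spaceVec k)| := by
            gcongr; exact abs_dirCos_le_one k Ω
        _ ≤ G * ε := by rw [one_mul]; exact hG ε hε z hz k Ω (axisDir 0)
    rw [h3, abs_neg, abs_mul]
    calc _ ≤ |(σ z)⁻¹| * (|ε ^ 2 * (D Ω (1, 0) / c)|
          + |ε * ∑ k, dirCos k Ω * (D Ω (spaceVec k) - D (axisDir 0) (spaceVec k))|) := by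
          gcongr; exact abs_add_le _ _
      _ ≤ B₂ * (ε ^ 2 * (B₁ / c) + ε * (3 * (G * ε))) := by
          rw [abs_mul, abs_mul, abs_div, abs_of_pos hc, abs_of_pos hε0,
            abs_of_pos (by positivity : 0 < ε ^ 2)]
          gcongr
          exact (hB₂ z hz).1
      _ = _ := by ring
  refine (hM' (I ε z) _ β b (hreg.continuous hzU) hb).mono fun x y hxy => ?_
  linarith

end ThickRegime

end

theorem lemma3 (L : ℕ) (C : ℕ → ℝ) (hp : IsPhaseFunction L C)
    (U : Set SpaceTime) (hU : IsOpen U)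
    (σ : SpaceTime → ℝ) (hσ : ContDiffOn ℝ 1 σ U) (hσ_pos : ∀ z ∈ U, 0 < σ z) :
    (∀ (c ε₀ : ℝ) (I : ℝ → SpaceTime → Direction → ℝ), 0 < c → 0 < ε₀ →
      IsThickFamily L C c σ ε₀ U I →
        ∀ K ⊆ U, IsCompact K → ∃ M : ℝ, ∀ ε ∈ Ioo 0 ε₀, ∀ z ∈ K,
          OddMomentRelations (fun a b => |a - b| ≤ M * ε ^ 2) (I ε z)) ∧
    (∀ (ε : ℝ) (I : SpaceTime → Direction → ℝ), 0 < ε →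
      RegularIntensity 1 U I → SatisfiesClosure L C σ ε U I →
        ∀ z ∈ U, OddMomentRelations (fun a b => a = b) (I z)) := by
  refine ⟨fun c ε₀ I hc _ hI K hKU hK => ?_, fun ε I _ hreg hcl z hz => ?_⟩
  · exact hI.oddMomentRelations hp hU hσ hσ_pos hc hKU hK
  · exact hcl.oddMomentRelations hp hU hreg hz
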